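/- Consider a finite-dimensional tensor product space $\mathcal H=\bigotimes_{i=1}^n\mathcal H_i$, with $\mathcal{H}_i$ complex Hilbert spaces. A product state is a nonzero vector of the form $v_1\otimes\cdots\otimes v_n$ (not necessarily normalized). An orthogonal product set (OPS) in $\mathcal H$ is a set of mutually orthogonal product states, and an orthogonal product basis (OPB) is an OPS that spans $\mathcal H$. Let $\mathcal S$ be an OPS whose span $\mathcal H_{\mathcal S}$ satisfies $\dim\mathcal H_{\mathcal S}<\dim\mathcal H$. Then $\mathcal S$ is called an unextendible product basis (UPB) if $\mathcal H_{\mathcal S}^{\perp}$ contains no product state; an uncompletable product basis (UCPB) if $\mathcal S$ is not contained in any OPB of $\mathcal H$; and a strongly uncompletable product basis (SUCPB) if it is a UCPB in $\mathcal H$ and in every locally extended space $\bigotimes_{i=1}^n(\mathcal H_i\oplus\mathcal H_i')$, where the $\mathcal H_i'$ are arbitrary finite-dimensional Hilbert spaces. Theorem. For all integers $d_1,d_2,d_3\ge 3$ there exists a UPB $\mathcal S$ in $\mathbb C^{d_1}\otimes\mathbb C^{d_2}\otimes\mathbb C^{d_3}$ which is an SUCPB in every bipartition; that is, for each of the bipartitions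 $A|BC$, $B|AC$, $C|AB$ of the three parties, $\mathcal S$, regarded as an OPS of the corresponding bipartite space ($\mathbb C^{d_1}\otimes\mathbb C^{d_2d_3}$, $\mathbb C^{d_2}\otimes\mathbb C^{d_1d_3}$, $\mathbb C^{d_3}\otimes\mathbb C^{d_1d_2}$, respectively), is an SUCPB. -/

import Mathlib

namespace ProductBases

/-- The Hilbert space of a system with parties `I`, where party `i` has the local space
`H i = ℂ^(κ i)` with computational basis indexed by `κ i`.  The tensor product of the `H i` is
written in its computational product basis, so that its orthonormal basis is indexed by
`x : ∀ i, κ i` (the basis vector `x` is the tensor product of the local basis vectors `x i`). -/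
abbrev System {I : Type} (κ : I → Type) : Type := EuclideanSpace ℂ (∀ i, κ i)

section General

variable {I : Type} [Fintype I] [DecidableEq I] {κ : I → Type} [∀ i, Fintype (κ i)]

/-- The tensor product of the local vectors `v i`. -/
noncomputable def tensor (v : ∀ i, EuclideanSpace ℂ (κ i)) : System κ :=
  WithLp.toLp 2 (fun x => ∏ i, v i (x i))

/-- A (not necessarily normalized) product state: a nonzero tensor product of local vectors. -/
def IsProductState (ψ : System κ) : Prop :=
  ψ ≠ 0 ∧ ∃ v : ∀ i, EuclideanSpace ℂ (κ i), ψ = tensor v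

/-- Orthogonal product set: a set of mutually orthogonal product states. -/
def IsOPS (S : Set (System κ)) : Prop :=
  (∀ ψ ∈ S, IsProductState ψ) ∧ S.Pairwise (fun ψ φ => inner ℂ ψ φ = 0)

/-- (Complete) orthogonal product basis: an orthogonal product set that spans the whole space. -/
def IsOPB (S : Set (System κ)) : Prop :=
  IsOPS S ∧ Submodule.span ℂ S = ⊤

/-- An orthogonal product set whose span has smaller dimension than the whole space. -/
def IsIncompleteOPS (S : Set (System κ)) : Prop :=
  IsOPS S ∧ Module.finrank ℂ (Submodule.span ℂ S) < Module.finrank ℂ (System κ)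

/-- Unextendible product basis: an incomplete orthogonal product set such that the orthogonal
complement of its span contains no product state. -/
def IsUPB (S : Set (System κ)) : Prop :=
  IsIncompleteOPS S ∧ ∀ ψ ∈ (Submodule.span ℂ S)ᗮ, ¬ IsProductState ψ

/-- Uncompletable product basis: an incomplete orthogonal product set that cannot be extended to
an orthogonal product basis of the space. -/
def IsUCPB (S : Set (System κ)) : Prop :=
  IsIncompleteOPS S ∧ ¬ ∃ T : Set (System κ), S ⊆ T ∧ IsOPB T

/-- The canonical embedding of the tensor product of the `H i` into the locally extended space,
the tensor product of the `H i ⊕ ℂ^(m i)`: coefficients are extended by zero. -/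
noncomputable def localExt (m : I → ℕ) (ψ : System κ) : System (fun i => κ i ⊕ Fin (m i)) :=
  WithLp.toLp 2
    (Function.extend (fun (x : ∀ i, κ i) (i : I) => (Sum.inl (x i) : κ i ⊕ Fin (m i))) ψ 0)

/-- Strongly uncompletable product basis: a UCPB that remains a UCPB in every locally extended
Hilbert space. -/
def IsSUCPB (S : Set (System κ)) : Prop :=
  IsUCPB S ∧ ∀ m : I → ℕ, IsUCPB (localExt m '' S)

end General

/-- The local basis labels after the parties in each block `{i | P i = b}` have been merged into a
single party `b`. -/
abbrev Merged {I J : Type} (P : I → J) (κ : I → Type) (b : J) : Type :=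
  ∀ i : {i : I // P i = b}, κ i

/-- The same vector, viewed in the system whose parties are the blocks of the partition `P`. -/
noncomputable def regroup {I J : Type} (P : I → J) {κ : I → Type} (ψ : System κ) :
    System (Merged P κ) :=
  WithLp.toLp 2 (fun y => ψ (fun i => y (P i) ⟨i, rfl⟩))

/-- `S` is an SUCPB in every bipartition of the parties.  A bipartition is a division of the
parties into two nonempty blocks, i.e. a surjection `P` onto a two-element set. -/
def IsSUCPBInEveryBipartition {I : Type} [Fintype I] [DecidableEq I] {κ : I → Type}
    [∀ i, Fintype (κ i)] (S : Set (System κ)) : Prop :=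
  ∀ P : I → Fin 2, Function.Surjective P → IsSUCPB (regroup P '' S)

end ProductBases

/-! Merge all local levels from 2 on, so that the basis becomes a 3 × 3 × 3 cube, and split it into
nine interlocking boxes: two opposite corners, the center, and six 2 × 2 × 1 boxes around it. `S`
consists of the all-ones vector and, for each box, a product orthonormal basis of the vectors
supported there with its constant member removed. Hence the complement of its span is the space of
box-constant vectors of total sum zero (`exists_isOPS_of_boxes`).

A vector of sum zero with at most one nonzero value is zero. The interlocking leaves a box-constant
fully product vector at most one nonzero value (`values_of_product`), so `S` is a UPB. Across a
bipartition less is true, but enough: if the center value is nonzero, the 2 × 2 minors force every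
value to be zero or equal to it (`values_of_minors_first`). So every product state in the complement
vanishes at the center, although some vector of the complement does not.

This obstruction survives local extension (`isUCPB_image_extendAlong`): the new states of a
completion restrict to zero or to product states in the complement, so they all vanish at the center
and cannot span what is missing. -/

namespace ProductBases

/-! ### Extension and restriction of coefficients. -/

section Coefficients

variable {I : Type} {κ κ' : I → Type}

/-- Extension of coefficients by zero along local inclusions of computational bases. -/
noncomputable def extendAlong (e : ∀ i, κ i → κ' i) (ψ : System κ) : System κ' :=
  WithLp.toLp 2 (Function.extend (fun (x : ∀ i, κ i) i => e i (x i)) ψ 0)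

/-- Restriction of coefficients along local inclusions of computational bases. -/
noncomputable def restrictAlong (e : ∀ i, κ i → κ' i) (ψ : System κ') : System κ :=
  WithLp.toLp 2 (fun x => ψ (fun i => e i (x i)))

theorem extendAlong_apply {e : ∀ i, κ i → κ' i} (he : ∀ i, Function.Injective (e i))
    (ψ : System κ) (x : ∀ i, κ i) : extendAlong e ψ (fun i => e i (x i)) = ψ x :=
  (Function.Injective.piMap he).extend_apply _ _ x

theorem restrictAlong_extendAlong {e : ∀ i, κ i → κ' i} (he : ∀ i, Function.Injective (e i))
    (ψ : System κ) : restrictAlong e (extendAlong e ψ) = ψ := by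
  ext x
  exact extendAlong_apply he ψ x

theorem extendAlong_tensor [Fintype I] {e : ∀ i, κ i → κ' i} (he : ∀ i, Function.Injective (e i))
    (v : ∀ i, EuclideanSpace ℂ (κ i)) :
    extendAlong e (tensor v) =
      tensor (fun i => WithLp.toLp 2 (Function.extend (e i) (v i) 0)) := by
  ext y
  by_cases hy : ∃ x : ∀ i, κ i, (fun i => e i (x i)) = y
  · obtain ⟨x, rfl⟩ := hy
    rw [extendAlong_apply he]
    simp [tensor, (he _).extend_apply]
  · have h0 : extendAlong e (tensor v) y = 0 := Function.extend_apply' _ _ _ hy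
    rw [h0]
    have : ∃ i, ¬ ∃ a, e i a = y i := by
      by_contra! h
      choose x hx using h
      exact hy ⟨x, funext hx⟩
    obtain ⟨i, hi⟩ := this
    symm
    exact Finset.prod_eq_zero (Finset.mem_univ i) (Function.extend_apply' _ _ _ hi)

end Coefficients

/-! ### Uncompletability in local extensions. -/

section General

variable {I : Type} [Fintype I] [DecidableEq I] {κ κ' : I → Type} [∀ i, Fintype (κ i)]
  [∀ i, Fintype (κ' i)]

theorem inner_eq_sum {α : Type*} [Fintype α] (ψ φ : EuclideanSpace ℂ α) :
    inner ℂ ψ φ = ∑ x, starRingEnd ℂ (ψ x) * φ x := by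
  simp [PiLp.inner_apply, mul_comm]

theorem inner_tensor (u v : ∀ i, EuclideanSpace ℂ (κ i)) :
    inner ℂ (tensor u) (tensor v) = ∏ i, inner ℂ (u i) (v i) := by
  simp only [inner_eq_sum, tensor, map_prod, ← Finset.prod_mul_distrib]
  rw [Finset.prod_univ_sum, Fintype.piFinset_univ]

theorem mem_orthogonal_span_iff {E : Type*} [NormedAddCommGroup E] [InnerProductSpace ℂ E]
    (S : Set E) (w : E) : w ∈ (Submodule.span ℂ S)ᗮ ↔ ∀ s ∈ S, inner ℂ s w = 0 := by
  constructor
  · intro h s hs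
    exact (Submodule.mem_orthogonal _ _).1 h s (Submodule.subset_span hs)
  · intro h
    rw [Submodule.mem_orthogonal]
    intro u hu
    induction hu using Submodule.span_induction with
    | mem x hx => exact h x hx
    | zero => simp
    | add x y _ _ hx hy => simp [inner_add_left, hx, hy]
    | smul a x _ hx => simp [inner_smul_left, hx]

theorem finrank_span_lt {E : Type*} [NormedAddCommGroup E] [InnerProductSpace ℂ E]
    [FiniteDimensional ℂ E] {S : Set E} {w : E} (hw : w ∈ (Submodule.span ℂ S)ᗮ) (h0 : w ≠ 0) :
    Module.finrank ℂ (Submodule.span ℂ S) < Module.finrank ℂ E := by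
  apply Submodule.finrank_lt
  intro h
  rw [h, Submodule.top_orthogonal_eq_bot] at hw
  exact h0 (by simpa using hw)

/-- Extension by zero and restriction are adjoint; this carries orthogonality to `S` between the
original and the extended space. -/
theorem inner_extendAlong {e : ∀ i, κ i → κ' i} (he : ∀ i, Function.Injective (e i))
    (ψ : System κ) (φ : System κ') :
    inner ℂ (extendAlong e ψ) φ = inner ℂ ψ (restrictAlong e φ) := by
  rw [inner_eq_sum, inner_eq_sum]
  symm
  refine Finset.sum_of_injOn (fun (x : ∀ i, κ i) i => e i (x i)) (Function.Injective.piMap he).injOn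
    (by simp) ?_ ?_
  · intro y _ hy
    have : extendAlong e ψ y = 0 :=
      Function.extend_apply' _ _ _ (fun ⟨x, hx⟩ => hy ⟨x, by simp, hx⟩)
    simp [this]
  · intro x _
    rw [extendAlong_apply he]
    rfl

theorem IsOPS.image_extendAlong {e : ∀ i, κ i → κ' i} (he : ∀ i, Function.Injective (e i))
    {S : Set (System κ)} (hS : IsOPS S) : IsOPS (extendAlong e '' S) := by
  refine ⟨?_, ?_⟩
  · rintro _ ⟨ψ, hψ, rfl⟩
    obtain ⟨h0, v, rfl⟩ := hS.1 ψ hψ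
    refine ⟨fun h => h0 ?_, _, extendAlong_tensor he v⟩
    rw [← restrictAlong_extendAlong he (tensor v), h]
    rfl
  · rintro _ ⟨ψ, hψ, rfl⟩ _ ⟨φ, hφ, rfl⟩ hne
    rw [inner_extendAlong he, restrictAlong_extendAlong he]
    exact hS.2 hψ hφ (fun h => hne (h ▸ rfl))

/-- If all product states in the orthogonal complement of an orthogonal product set `S` vanish at
a coordinate at which the complement itself does not vanish, then `S` is uncompletable in every
local extension. -/
theorem isUCPB_image_extendAlong {e : ∀ i, κ i → κ' i} (he : ∀ i, Function.Injective (e i))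
    {S : Set (System κ)} (hS : IsOPS S) {x₀ : ∀ i, κ i} {w : System κ}
    (hw : w ∈ (Submodule.span ℂ S)ᗮ) (hw0 : w x₀ ≠ 0)
    (hprod : ∀ ψ ∈ (Submodule.span ℂ S)ᗮ, IsProductState ψ → ψ x₀ = 0) :
    IsUCPB (extendAlong e '' S) := by
  have hw' : extendAlong e w ∈ (Submodule.span ℂ (extendAlong e '' S))ᗮ := by
    rw [mem_orthogonal_span_iff] at hw ⊢
    rintro _ ⟨s, hs, rfl⟩
    rw [inner_extendAlong he, restrictAlong_extendAlong he]
    exact hw s hs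
  have hval : extendAlong e w (fun i => e i (x₀ i)) ≠ 0 := by
    rwa [extendAlong_apply he]
  refine ⟨⟨hS.image_extendAlong he, finrank_span_lt hw' (fun h => hval (by rw [h]; rfl))⟩, ?_⟩
  rintro ⟨T, hST, hT, hspan⟩
  have hperp : ∀ t ∈ T \ (extendAlong e '' S),
      t ∈ (Submodule.span ℂ (extendAlong e '' S))ᗮ := by
    rintro t ⟨htT, htS⟩
    rw [mem_orthogonal_span_iff]
    intro s hs
    exact hT.2 (hST hs) htT (fun h => htS (h ▸ hs))
  -- Restricting a tensor restricts each factor, so a new state restricts to zero or to a product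
  -- state orthogonal to `S`.
  have hvanish : ∀ t ∈ Submodule.span ℂ (T \ (extendAlong e '' S)),
      t (fun i => e i (x₀ i)) = 0 := by
    intro t ht
    induction ht using Submodule.span_induction with
    | mem t ht =>
      by_cases h0 : restrictAlong e t = 0
      · exact congrArg (fun φ : System κ => φ x₀) h0
      · obtain ⟨_, v, rfl⟩ := hT.1 t ht.1
        refine hprod (restrictAlong e (tensor v)) ?_ ⟨h0,
          fun i => WithLp.toLp 2 (fun z => v i (e i z)), rfl⟩
        have := hperp _ ht
        rw [mem_orthogonal_span_iff] at this ⊢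
        intro s hs
        rw [← inner_extendAlong he]
        exact this _ ⟨s, hs, rfl⟩
    | zero => rfl
    | add x y _ _ hx hy => simp [hx, hy]
    | smul a x _ hx => simp [hx]
  have hmem : extendAlong e w ∈ Submodule.span ℂ (extendAlong e '' S) ⊔
      Submodule.span ℂ (T \ (extendAlong e '' S)) := by
    rw [← Submodule.span_union, Set.union_sdiff_cancel hST, hspan]
    trivial
  obtain ⟨u, hu, v, hv, huv⟩ := Submodule.mem_sup.1 hmem
  have hv' : v ∈ (Submodule.span ℂ (extendAlong e '' S))ᗮ :=
    Submodule.span_le.2 hperp hv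
  have hu' : u ∈ (Submodule.span ℂ (extendAlong e '' S))ᗮ := by
    have : u = extendAlong e w - v := by rw [← huv, add_sub_cancel_right]
    rw [this]
    exact Submodule.sub_mem _ hw' hv'
  -- `u` lies both in the span and in its orthogonal complement.
  have hu0 : u = 0 := by
    have := (Submodule.mem_orthogonal _ _).1 hu' u hu
    exact inner_self_eq_zero.1 this
  rw [hu0, zero_add] at huv
  exact hval (huv ▸ hvanish v hv)

theorem isSUCPB_of_product_states_vanish {S : Set (System κ)} (hS : IsOPS S) {x₀ : ∀ i, κ i}
    {w : System κ} (hw : w ∈ (Submodule.span ℂ S)ᗮ) (hw0 : w x₀ ≠ 0)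
    (hprod : ∀ ψ ∈ (Submodule.span ℂ S)ᗮ, IsProductState ψ → ψ x₀ = 0) : IsSUCPB S := by
  refine ⟨?_, fun m => isUCPB_image_extendAlong (e := fun i => (Sum.inl : κ i → κ i ⊕ Fin (m i)))
    (fun i => Sum.inl_injective) hS hw hw0 hprod⟩
  -- The unextended space is the case of identity inclusions.
  have h := isUCPB_image_extendAlong (e := fun i => (id : κ i → κ i))
    (fun i => Function.injective_id) hS hw hw0 hprod
  have hid : extendAlong (fun i => (id : κ i → κ i)) = id := by
    funext ψ
    ext x
    exact extendAlong_apply (fun i => Function.injective_id) ψ x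
  rwa [hid, Set.image_id] at h

end General

/-! ### Regrouping of parties. -/

/-- Basis labels of the regrouped system correspond to basis labels of the original one. -/
def regroupEquiv {I J : Type} (P : I → J) {κ : I → Type} : (∀ b, Merged P κ b) ≃ (∀ i, κ i) where
  toFun y i := y (P i) ⟨i, rfl⟩
  invFun x _ i := x i.1
  left_inv y := by
    funext b ⟨i, hi⟩
    subst hi
    rfl
  right_inv _ := rfl

theorem regroup_surjective {I J : Type} (P : I → J) {κ : I → Type} :
    Function.Surjective (regroup P : System κ → System (Merged P κ)) := by
  intro ψ
  refine ⟨WithLp.toLp 2 (fun x => ψ ((regroupEquiv P).symm x)), ?_⟩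
  ext y
  exact congrArg ψ ((regroupEquiv P).symm_apply_apply y)

theorem regroup_tensor {I J : Type} [Fintype I] [Fintype J] [DecidableEq J] (P : I → J)
    {κ : I → Type} (v : ∀ i, EuclideanSpace ℂ (κ i)) :
    regroup P (tensor v) =
      tensor (fun b => WithLp.toLp 2 (fun z : Merged P κ b => ∏ i, v i.1 (z i))) := by
  ext y
  obtain ⟨x, rfl⟩ := (regroupEquiv P (κ := κ)).symm.surjective y
  change ∏ i, v i (x i) = ∏ b, ∏ i : {i // P i = b}, v i.1 (x i.1)
  exact (Fintype.prod_fiberwise P fun i => v i (x i)).symm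

section Regroup

variable {I J : Type} [Fintype I] [DecidableEq I] [Fintype J] [DecidableEq J] (P : I → J)
  {κ : I → Type} [∀ i, Fintype (κ i)]

theorem inner_regroup (ψ φ : System κ) :
    inner ℂ (regroup P ψ) (regroup P φ) = inner ℂ ψ φ := by
  rw [inner_eq_sum, inner_eq_sum]
  exact (regroupEquiv P (κ := κ)).sum_comp (fun x => starRingEnd ℂ (ψ x) * φ x)

theorem regroup_ne_zero {ψ : System κ} (h : ψ ≠ 0) : regroup P ψ ≠ 0 := by
  intro h0
  apply h
  have := inner_regroup P ψ ψ
  rw [h0, inner_zero_left] at this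
  exact inner_self_eq_zero.1 this.symm

theorem IsOPS.image_regroup {S : Set (System κ)} (hS : IsOPS S) : IsOPS (regroup P '' S) := by
  refine ⟨?_, ?_⟩
  · rintro _ ⟨ψ, hψ, rfl⟩
    obtain ⟨h0, v, rfl⟩ := hS.1 ψ hψ
    exact ⟨regroup_ne_zero P h0, _, regroup_tensor P v⟩
  · rintro _ ⟨ψ, hψ, rfl⟩ _ ⟨φ, hφ, rfl⟩ hne
    rw [inner_regroup]
    exact hS.2 hψ hφ (fun h => hne (h ▸ rfl))

theorem regroup_mem_orthogonal_iff (S : Set (System κ)) (w : System κ) :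
    regroup P w ∈ (Submodule.span ℂ (regroup P '' S))ᗮ ↔ w ∈ (Submodule.span ℂ S)ᗮ := by
  simp [mem_orthogonal_span_iff, inner_regroup]

end Regroup

/-- A vector that is a product across a bipartition has vanishing two by two minors. -/
theorem minors_of_isProductState_regroup {I : Type} (P : I → Fin 2) {κ : I → Type}
    {φ : System κ}
    (h : IsProductState (regroup P φ)) (x y : ∀ i, κ i) :
    φ x * φ y = φ (fun i => if P i = 0 then x i else y i) *
      φ (fun i => if P i = 0 then y i else x i) := by
  obtain ⟨_, v, hv⟩ := h
  have key : ∀ x : ∀ i, κ i, φ x = v 0 (fun i => x i.1) * v 1 (fun i => x i.1) := by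
    intro x
    have := congrArg (fun ψ : System (Merged P κ) => ψ ((regroupEquiv P).symm x)) hv
    simpa [tensor, Fin.prod_univ_two, regroup, regroupEquiv] using this
  have h0 : ∀ x y : ∀ i, κ i, (fun i : {i // P i = 0} => if P i.1 = 0 then x i.1 else y i.1) =
      fun i : {i // P i = 0} => x i.1 := fun x y => funext fun i => if_pos i.2
  have h1 : ∀ x y : ∀ i, κ i, (fun i : {i // P i = 1} => if P i.1 = 0 then x i.1 else y i.1) =
      fun i : {i // P i = 1} => y i.1 := fun x y => funext fun i => if_neg (by rw [i.2]; decide)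
  rw [key x, key y, key, key, h0, h0, h1, h1]
  ring


/-! ### Combinatorics of the nine boxes. -/

/-- The partition of the `3 × 3 × 3` cube into nine boxes: opposite corners `0` and `7`, the
center `8`, and six boxes with two by two by one cells. -/
def cubeBox : Fin 9 → Fin 3 → Finset (Fin 3) :=
  ![![{0}, {0}, {0}], ![{0}, {1, 2}, {0, 1}], ![{0, 1}, {0}, {1, 2}], ![{1, 2}, {0, 1}, {0}],
    ![{2}, {0, 1}, {1, 2}], ![{1, 2}, {2}, {0, 1}], ![{0, 1}, {1, 2}, {2}], ![{2}, {2}, {2}],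
    ![{1}, {1}, {1}]]

/-- The index of the box of `cubeBox` that contains a given cell. -/
def cubeLabel : Fin 3 → Fin 3 → Fin 3 → Fin 9 :=
  ![![![0, 2, 2], ![1, 1, 6], ![1, 1, 6]], ![![3, 2, 2], ![3, 8, 6], ![5, 5, 6]],
    ![![3, 4, 4], ![3, 4, 4], ![5, 5, 7]]]

theorem cubeLabel_eq_iff : ∀ (t : Fin 9) (i j k : Fin 3),
    cubeLabel i j k = t ↔ i ∈ cubeBox t 0 ∧ j ∈ cubeBox t 1 ∧ k ∈ cubeBox t 2 := by
  decide

theorem cubeBox_nonempty : ∀ t i, (cubeBox t i).Nonempty := by decide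

theorem exists_disjoint_cubeBox : ∀ s t, s ≠ t → ∃ i, Disjoint (cubeBox s i) (cubeBox t i) := by
  decide

/-- The action on boxes of the cyclic rotation of the three parties. -/
def cubeRotation : Fin 9 → Fin 9 := ![0, 2, 3, 1, 5, 6, 4, 7, 8]

/-- This symmetry reduces statements about any party to statements about the first. -/
theorem cubeLabel_rotate : ∀ i j k, cubeLabel k i j = cubeRotation (cubeLabel i j k) := by
  decide

theorem cubeRotation_surjective : Function.Surjective cubeRotation := by
  unfold Function.Surjective
  decide

theorem forall_fin_nine {p : Fin 9 → Prop} (h0 : p 0) (h1 : p 1) (h2 : p 2) (h3 : p 3)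
    (h4 : p 4) (h5 : p 5) (h6 : p 6) (h7 : p 7) (h8 : p 8) : ∀ t, p t := by
  intro t
  fin_cases t <;> assumption

/-- A box-constant tensor of rank one across the first bipartition and nonzero at the center takes
no nonzero value besides the one at the center. -/
theorem values_of_minors_first (c : Fin 9 → ℂ)
    (h : ∀ i i' j j' k k', c (cubeLabel i j k) * c (cubeLabel i' j' k') =
      c (cubeLabel i' j k) * c (cubeLabel i j' k')) (h8 : c 8 ≠ 0) (t : Fin 9) :
    c t = 0 ∨ c t = c 8 := by
  -- Every minor used passes through the center cell. The line in the first direction through it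
  -- reads `(c 1, c 8, c 4)`, and all parallel lines are proportional to each other.
  have e1 : c 1 * c 2 = c 8 * c 2 := h 0 1 1 0 1 1
  have e2 : c 8 * c 4 = c 4 * c 2 := h 1 2 1 0 1 1
  have e3 : c 1 * c 3 = c 8 * c 1 := h 0 1 1 1 1 0
  have e4 : c 8 * c 3 = c 4 * c 3 := h 1 2 1 1 1 0
  have e5 : c 1 * c 5 = c 8 * c 1 := h 0 1 1 2 1 0
  have e6 : c 8 * c 5 = c 4 * c 5 := h 1 2 1 2 1 0
  have e7 : c 1 * c 6 = c 8 * c 6 := h 0 1 1 1 1 2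
  have e8 : c 8 * c 4 = c 4 * c 6 := h 1 2 1 1 1 2
  have e9 : c 1 * c 3 = c 8 * c 0 := h 0 1 1 0 1 0
  have e10 : c 8 * c 7 = c 4 * c 6 := h 1 2 1 2 1 2
  -- If `c 1 = 0`, then also `c 4 = 0`, so the tensor lives on the middle slab, which every box but
  -- the center leaves. Otherwise equality with `c 8` propagates from box to box.
  by_cases h1 : c 1 = 0
  · have h2 : c 2 = 0 := by simpa [h1, h8] using e1
    have h4 : c 4 = 0 := by simpa [h2, h8] using e2
    have h3 : c 3 = 0 := by simpa [h4, h8] using e4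
    have h5 : c 5 = 0 := by simpa [h4, h8] using e6
    have h6 : c 6 = 0 := by simpa [h1, h8] using e7
    have h0 : c 0 = 0 := by simpa [h1, h8] using e9
    have h7 : c 7 = 0 := by simpa [h4, h8] using e10
    revert t
    apply forall_fin_nine <;> simp [*]
  · have h3 : c 3 = c 8 := mul_left_cancel₀ h1 (by rw [e3, mul_comm])
    have h5 : c 5 = c 8 := mul_left_cancel₀ h1 (by rw [e5, mul_comm])
    have h4 : c 4 = c 8 := (mul_right_cancel₀ (h3 ▸ h8) e4).symm
    have h2 : c 2 = c 8 := by
      rw [h4] at e2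
      exact (mul_left_cancel₀ h8 e2).symm
    have h6 : c 6 = c 8 := by
      rw [h4] at e8
      exact (mul_left_cancel₀ h8 e8).symm
    have h1' : c 1 = c 8 := mul_right_cancel₀ (h2 ▸ h8) e1
    have h0 : c 0 = c 8 := by
      rw [h1', h3] at e9
      exact (mul_left_cancel₀ h8 e9).symm
    have h7 : c 7 = c 8 := by
      rw [h4, h6] at e10
      exact mul_left_cancel₀ h8 e10
    revert t
    apply forall_fin_nine <;> simp [*]

theorem values_of_minors_second (c : Fin 9 → ℂ)
    (h : ∀ i i' j j' k k', c (cubeLabel i j k) * c (cubeLabel i' j' k') =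
      c (cubeLabel i j' k) * c (cubeLabel i' j k')) (h8 : c 8 ≠ 0) (t : Fin 9) :
    c t = 0 ∨ c t = c 8 := by
  obtain ⟨s, rfl⟩ := cubeRotation_surjective t
  refine values_of_minors_first (c ∘ cubeRotation) (fun i i' j j' k k' => ?_) h8 s
  simp only [Function.comp_apply, ← cubeLabel_rotate]
  exact h k k' i i' j j'

theorem values_of_minors_third (c : Fin 9 → ℂ)
    (h : ∀ i i' j j' k k', c (cubeLabel i j k) * c (cubeLabel i' j' k') =
      c (cubeLabel i j k') * c (cubeLabel i' j' k)) (h8 : c 8 ≠ 0) (t : Fin 9) :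
    c t = 0 ∨ c t = c 8 := by
  obtain ⟨s, rfl⟩ := cubeRotation_surjective t
  refine values_of_minors_second (c ∘ cubeRotation) (fun i i' j j' k k' => ?_) h8 s
  simp only [Function.comp_apply, ← cubeLabel_rotate]
  exact h k k' i i' j j'

/-- The boxes meeting the middle slab get value zero. Only boxes 0, 1, 4, 7 remain, and minors make
the product of any two of their values vanish. -/
theorem values_of_product_of_middle_zero (c : Fin 9 → ℂ) (a b d : Fin 3 → ℂ)
    (h : ∀ i j k, c (cubeLabel i j k) = a i * b j * d k) (ha : a 1 = 0) :
    ∀ s t, c s ≠ 0 → c t ≠ 0 → c s = c t := by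
  have h2 : c 2 = 0 := (h 1 0 1).trans (by simp [ha])
  have h3 : c 3 = 0 := (h 1 0 0).trans (by simp [ha])
  have h5 : c 5 = 0 := (h 1 2 0).trans (by simp [ha])
  have h6 : c 6 = 0 := (h 1 1 2).trans (by simp [ha])
  have h8 : c 8 = 0 := (h 1 1 1).trans (by simp [ha])
  have minor : ∀ i j k i' j' k', c (cubeLabel i j k) * c (cubeLabel i' j' k') =
      c (cubeLabel i' j k) * c (cubeLabel i j' k') := by
    intro i j k i' j' k'
    simp only [h]
    ring
  have minor' : ∀ i j k i' j' k', c (cubeLabel i j k) * c (cubeLabel i' j' k') =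
      c (cubeLabel i j' k) * c (cubeLabel i' j k') := by
    intro i j k i' j' k'
    simp only [h]
    ring
  have e1 : c 0 * c 4 = c 3 * c 2 := minor 0 0 0 2 0 1
  have e2 : c 0 * c 7 = c 3 * c 6 := minor 0 0 0 2 2 2
  have e3 : c 1 * c 4 = c 3 * c 2 := minor 0 1 0 2 0 1
  have e4 : c 1 * c 7 = c 3 * c 6 := minor 0 1 0 2 2 2
  have e5 : c 0 * c 1 = c 1 * c 2 := minor' 0 0 0 0 1 1
  have e6 : c 4 * c 7 = c 5 * c 4 := minor' 2 0 1 2 2 2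
  simp only [h2, h3, h5, mul_zero, zero_mul, mul_eq_zero] at e1 e2 e3 e4 e5 e6
  apply forall_fin_nine <;> apply forall_fin_nine <;> intro hs ht <;> first | rfl | tauto

/-- If the center value is nonzero, rank one across a bipartition suffices. Otherwise some factor
vanishes at level 1, and rotation makes it the first. -/
theorem values_of_product (c : Fin 9 → ℂ) (a b d : Fin 3 → ℂ)
    (h : ∀ i j k, c (cubeLabel i j k) = a i * b j * d k) :
    ∀ s t, c s ≠ 0 → c t ≠ 0 → c s = c t := by
  by_cases h8 : c 8 = 0
  · have h111 : a 1 * b 1 * d 1 = 0 := (h 1 1 1).symm.trans h8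
    rcases mul_eq_zero.1 h111 with hab | hd
    · rcases mul_eq_zero.1 hab with ha | hb
      · exact values_of_product_of_middle_zero c a b d h ha
      · have := values_of_product_of_middle_zero (c ∘ cubeRotation) b d a (fun i j k => by
          simp only [Function.comp_apply, ← cubeLabel_rotate, h]; ring) hb
        intro s t
        obtain ⟨s, rfl⟩ := cubeRotation_surjective s
        obtain ⟨t, rfl⟩ := cubeRotation_surjective t
        exact this s t
    · have := values_of_product_of_middle_zero (c ∘ cubeRotation ∘ cubeRotation) d a b
        (fun i j k => by
          simp only [Function.comp_apply, ← cubeLabel_rotate, h]; ring) hd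
      intro s t
      obtain ⟨s, rfl⟩ := (cubeRotation_surjective.comp cubeRotation_surjective) s
      obtain ⟨t, rfl⟩ := (cubeRotation_surjective.comp cubeRotation_surjective) t
      exact this s t
  · have := values_of_minors_first c (fun i i' j j' k k' => by simp only [h]; ring) h8
    intro s t hs ht
    rw [(this s).resolve_left hs, (this t).resolve_left ht]


/-! ### Orthogonal product sets from disjoint boxes. -/

/-- Orthonormal functions on a nonempty finite set `X`, extended by zero, one of them constant. -/
theorem exists_orthonormal_with_constant {α : Type} [Fintype α] [DecidableEq α] {X : Finset α}
    (hX : X.Nonempty) :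
    ∃ (r : X) (b : X → EuclideanSpace ℂ α),
      (∀ k, ∀ x ∉ X, b k x = 0) ∧
      (∀ k l, inner ℂ (b k) (b l) = if k = l then 1 else 0) ∧
      (∃ c : ℂ, c ≠ 0 ∧ ∀ x ∈ X, b r x = c) ∧
      ∀ x ∈ X, ∀ y, ∑ k, starRingEnd ℂ (b k y) * b k x = if y = x then 1 else 0 := by
  obtain ⟨r, hr⟩ := hX
  set one : EuclideanSpace ℂ X := WithLp.toLp 2 (fun _ => 1) with hone
  have hone0 : one ≠ 0 := fun h => one_ne_zero (congrArg (fun f => f ⟨r, hr⟩) h : (1 : ℂ) = 0)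
  have hn : (‖one‖ : ℂ) ≠ 0 := by simpa using hone0
  -- Only the member at `r` is prescribed: the normalized constant vector.
  obtain ⟨b, hb⟩ := Orthonormal.exists_orthonormalBasis_extension_of_card_eq (𝕜 := ℂ)
    (E := EuclideanSpace ℂ X) (ι := X) (by simp) (v := fun _ => (‖one‖ : ℂ)⁻¹ • one)
    (s := {⟨r, hr⟩}) (by
      constructor
      · intro i
        simp [norm_smul, hone0]
      · intro i j hij
        exact absurd (Subsingleton.elim i j) hij)
  let e : X → EuclideanSpace ℂ α := fun k =>
    WithLp.toLp 2 (fun x => if h : x ∈ X then b k ⟨x, h⟩ else 0)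
  have he : ∀ k (x : X), e k x = b k x := fun k x => dif_pos x.2
  have he0 : ∀ k, ∀ x ∉ X, e k x = 0 := fun k x hx => dif_neg hx
  refine ⟨⟨r, hr⟩, e, he0, ?_, ⟨(‖one‖ : ℂ)⁻¹, inv_ne_zero hn, ?_⟩, ?_⟩
  · intro k l
    rw [← orthonormal_iff_ite.1 b.orthonormal k l, inner_eq_sum, inner_eq_sum,
      ← Finset.sum_subset (Finset.subset_univ X), ← Finset.sum_coe_sort]
    · exact Finset.sum_congr rfl fun x _ => by rw [he, he]
    · intro x _ hx
      simp [he0 k x hx]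
  · intro x hx
    rw [he _ ⟨x, hx⟩, hb _ rfl]
    simp [hone]
  · intro x hx y
    by_cases hy : y ∈ X
    · have h := congrArg (fun f => f ⟨x, hx⟩) (b.sum_repr (EuclideanSpace.single ⟨y, hy⟩ (1 : ℂ)))
      simp only [b.repr_apply_apply, EuclideanSpace.inner_single_right, WithLp.ofLp_sum,
        Finset.sum_apply, PiLp.smul_apply, smul_eq_mul, one_mul, PiLp.single_apply,
        Subtype.mk.injEq] at h
      simp only [eq_comm (a := y), ← h]
      exact Finset.sum_congr rfl fun k _ => by rw [he k ⟨x, hx⟩, he k ⟨y, hy⟩]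
    · have hyx : y ≠ x := fun h => hy (h ▸ hx)
      simp [he0 _ y hy, hyx]

/-- The orthogonal product set attached to a family of disjoint boxes: its orthogonal complement
consists of the vectors which are constant on the boxes and have total sum zero. -/
theorem exists_isOPS_of_boxes {I : Type} [Fintype I] [DecidableEq I] {κ : I → Type}
    [∀ i, Fintype (κ i)] [∀ i, DecidableEq (κ i)] [∀ i, Nonempty (κ i)] {τ : Type}
    (X : τ → ∀ i, Finset (κ i)) (hX : ∀ t i, (X t i).Nonempty)
    (hdisj : ∀ s t, s ≠ t → ∃ i, Disjoint (X s i) (X t i)) :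
    ∃ S : Set (System κ), IsOPS S ∧ ∀ ψ : System κ, ψ ∈ (Submodule.span ℂ S)ᗮ ↔
      (∀ t x y, (∀ i, x i ∈ X t i) → (∀ i, y i ∈ X t i) → ψ x = ψ y) ∧ ∑ x, ψ x = 0 := by
  choose r b hsupp horth hconst hcompl using fun t i => exists_orthonormal_with_constant (hX t i)
  choose c hc0 hc using hconst
  let one : ∀ i, EuclideanSpace ℂ (κ i) := fun i => WithLp.toLp 2 (fun _ => 1)
  let st : ∀ t, (∀ i, X t i) → System κ := fun t k => tensor (fun i => b t i (k i))
  have hone : ∀ ψ : System κ, inner ℂ (tensor one) ψ = ∑ x, ψ x := by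
    intro ψ
    simp [inner_eq_sum, tensor, one]
  have hsum : ∀ t i k, k ≠ r t i → ∑ x, b t i k x = 0 := by
    intro t i k hk
    have h := horth t i (r t i) k
    rw [if_neg hk.symm, inner_eq_sum] at h
    have h' : starRingEnd ℂ (c t i) * ∑ x, b t i k x = 0 := by
      rw [← h, Finset.mul_sum]
      refine Finset.sum_congr rfl fun x _ => ?_
      by_cases hx : x ∈ X t i
      · rw [hc t i x hx]
      · simp [hsupp t i k x hx]
    exact (mul_eq_zero.1 h').resolve_left (by simpa using hc0 t i)
  have hone_st : ∀ t k, k ≠ r t → inner ℂ (tensor one) (st t k) = 0 := by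
    intro t k hk
    obtain ⟨i, hi⟩ := Function.ne_iff.1 hk
    rw [inner_tensor]
    refine Finset.prod_eq_zero (Finset.mem_univ i) ?_
    rw [← hsum t i (k i) hi]
    simp [inner_eq_sum, one]
  have hst_self : ∀ t k, inner ℂ (st t k) (st t k) = 1 := by
    intro t k
    rw [inner_tensor]
    exact Finset.prod_eq_one fun i _ => by rw [horth, if_pos rfl]
  have hst_zero : ∀ t k, ∀ x : ∀ i, κ i, (¬ ∀ i, x i ∈ X t i) → st t k x = 0 := by
    intro t k x hx
    push Not at hx
    obtain ⟨i, hi⟩ := hx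
    exact Finset.prod_eq_zero (Finset.mem_univ i) (hsupp t i (k i) (x i) hi)
  -- The index `r t` marks the constant member on box `t`; every other member has a factor of sum
  -- zero and so is orthogonal to the all-ones vector.
  refine ⟨{tensor one} ∪ {ψ | ∃ t k, k ≠ r t ∧ ψ = st t k}, ⟨?_, ?_⟩, ?_⟩
  · rintro ψ (rfl | ⟨t, k, -, rfl⟩)
    · refine ⟨fun h => ?_, one, rfl⟩
      have h1 : tensor one (fun i => Classical.arbitrary (κ i)) = 0 := by rw [h]; rfl
      simp [tensor, one] at h1
    · refine ⟨fun h => ?_, _, rfl⟩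
      have := hst_self t k
      rw [h, inner_zero_left] at this
      exact zero_ne_one this
  · rintro ψ (rfl | ⟨t, k, hk, rfl⟩) φ (rfl | ⟨s, l, hl, rfl⟩) hne
    · exact absurd rfl hne
    · exact hone_st s l hl
    · exact inner_eq_zero_symm.1 (hone_st t k hk)
    · by_cases hts : t = s
      · subst hts
        have hkl : k ≠ l := fun h => hne (h ▸ rfl)
        obtain ⟨i, hi⟩ := Function.ne_iff.1 hkl
        rw [inner_tensor]
        exact Finset.prod_eq_zero (Finset.mem_univ i) (by rw [horth, if_neg hi])
      · obtain ⟨i, hi⟩ := hdisj t s hts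
        rw [inner_tensor]
        refine Finset.prod_eq_zero (Finset.mem_univ i) ?_
        rw [inner_eq_sum]
        refine Finset.sum_eq_zero fun x _ => ?_
        by_cases hx : x ∈ X t i
        · rw [hsupp s i (l i) x (Finset.disjoint_left.1 hi hx), mul_zero]
        · rw [hsupp t i (k i) x hx, map_zero, zero_mul]
  · intro ψ
    rw [mem_orthogonal_span_iff]
    constructor
    · intro h
      refine ⟨?_, by rw [← hone]; exact h _ (Or.inl rfl)⟩
      have key : ∀ t (x : ∀ i, κ i), (∀ i, x i ∈ X t i) →
          ψ x = inner ℂ (st t (r t)) ψ * ∏ i, c t i := by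
        intro t x hx
        -- The local completeness relations multiply to one for the box. Orthogonality to `S` then
        -- leaves only the constant term `k = r t`.
        have expand : ∑ k, inner ℂ (st t k) ψ * st t k x = ψ x := by
          calc ∑ k, inner ℂ (st t k) ψ * st t k x
              = ∑ y, ψ y * ∏ i, ∑ k, starRingEnd ℂ (b t i k (y i)) * b t i k (x i) := by
                simp only [inner_eq_sum, Finset.sum_mul]
                rw [Finset.sum_comm]
                refine Finset.sum_congr rfl fun y _ => ?_
                rw [Finset.prod_univ_sum, Fintype.piFinset_univ, Finset.mul_sum]
                refine Finset.sum_congr rfl fun k _ => ?_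
                rw [Finset.prod_mul_distrib]
                simp only [st, tensor, map_prod]
                ring
            _ = ∑ y, if y = x then ψ y else 0 := by
                refine Finset.sum_congr rfl fun y _ => ?_
                rw [Finset.prod_congr rfl fun i _ => hcompl t i (x i) (hx i) (y i)]
                by_cases hyx : y = x
                · simp [hyx]
                · obtain ⟨i, hi⟩ := Function.ne_iff.1 hyx
                  rw [Finset.prod_eq_zero (Finset.mem_univ i) (if_neg hi), if_neg hyx, mul_zero]
            _ = ψ x := by simp
        rw [← expand, Finset.sum_eq_single (r t)]
        · congr 1
          exact Finset.prod_congr rfl fun i _ => hc t i (x i) (hx i)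
        · intro k _ hk
          rw [h _ (Or.inr ⟨t, k, hk, rfl⟩), zero_mul]
        · simp
      intro t x y hx hy
      rw [key t x hx, key t y hy]
    · rintro ⟨hψ, hψ0⟩ s (rfl | ⟨t, k, hk, rfl⟩)
      · rw [hone, hψ0]
      · have hx₀ : ∀ i, (r t i : κ i) ∈ X t i := fun i => (r t i).2
        -- On the support of `st t k`, `ψ` is a multiple of the all-ones vector.
        have : inner ℂ (st t k) ψ = inner ℂ (st t k) (tensor one) * ψ (fun i => r t i) := by
          rw [inner_eq_sum, inner_eq_sum, Finset.sum_mul]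
          refine Finset.sum_congr rfl fun x _ => ?_
          by_cases hx : ∀ i, x i ∈ X t i
          · rw [hψ t x _ hx hx₀]
            simp [tensor, one]
          · simp [hst_zero t k x hx]
        rw [this, inner_eq_zero_symm.1 (hone_st t k hk), zero_mul]


/-! ### The cube in general dimensions. -/

/-- Coarse graining of a local computational basis into three levels. -/
def coarse {n : ℕ} (x : Fin n) : Fin 3 :=
  if x.1 = 0 then 0 else if x.1 = 1 then 1 else 2

theorem coarse_castLE {n : ℕ} (hn : 3 ≤ n) : ∀ y : Fin 3, coarse (Fin.castLE hn y) = y := by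
  intro y
  fin_cases y <;> rfl

/-- A function with a single nonzero value and total sum zero does not attain that value. -/
theorem eq_zero_of_sum_eq_zero {α : Type*} [Fintype α] {f : α → ℂ} {c : ℂ}
    (hf : ∀ x, f x = 0 ∨ f x = c) (hsum : ∑ x, f x = 0) {x : α} (hx : f x = c) : c = 0 := by
  by_contra hc
  classical
  have h : ∑ x, f x = ((Finset.univ.filter fun x => f x = c).card : ℂ) * c := by
    rw [← nsmul_eq_mul, ← Finset.sum_const, Finset.sum_filter]
    refine Finset.sum_congr rfl fun y _ => ?_
    rcases hf y with h | h
    · rw [h, if_neg (Ne.symm hc)]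
    · rw [h, if_pos rfl]
  rw [h, mul_eq_zero, Nat.cast_eq_zero, Finset.card_eq_zero] at hsum
  have := hsum.resolve_right hc
  exact Finset.notMem_empty x (this ▸ Finset.mem_filter.2 ⟨Finset.mem_univ x, hx⟩)

section Cube

variable {d : Fin 3 → ℕ}

/-- The index of the box of the coarse grained cube which contains a basis label. -/
def boxLabel (x : ∀ i, Fin (d i)) : Fin 9 :=
  cubeLabel (coarse (x 0)) (coarse (x 1)) (coarse (x 2))

/-- The boxes of `cubeBox`, pulled back along the coarse graining. -/
def coarseBox (d : Fin 3 → ℕ) (t : Fin 9) (i : Fin 3) : Finset (Fin (d i)) :=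
  Finset.univ.filter fun x => coarse x ∈ cubeBox t i

theorem boxLabel_eq_iff {x : ∀ i, Fin (d i)} {t : Fin 9} :
    boxLabel x = t ↔ ∀ i, x i ∈ coarseBox d t i := by
  simp [boxLabel, cubeLabel_eq_iff, coarseBox, Fin.forall_fin_succ]

/-- The basis label with prescribed coarse levels. -/
def cell (hd : ∀ i, 3 ≤ d i) (i j k : Fin 3) : ∀ a, Fin (d a) :=
  fun a => Fin.castLE (hd a) (![i, j, k] a)

theorem boxLabel_cell (hd : ∀ i, 3 ≤ d i) (i j k : Fin 3) :
    boxLabel (cell hd i j k) = cubeLabel i j k := by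
  simp [boxLabel, cell, coarse_castLE]

theorem coarseBox_nonempty (hd : ∀ i, 3 ≤ d i) (t : Fin 9) (i : Fin 3) :
    (coarseBox d t i).Nonempty := by
  obtain ⟨y, hy⟩ := cubeBox_nonempty t i
  exact ⟨Fin.castLE (hd i) y, by simpa [coarseBox, coarse_castLE] using hy⟩

theorem exists_disjoint_coarseBox (s t : Fin 9) (hst : s ≠ t) :
    ∃ i, Disjoint (coarseBox d s i) (coarseBox d t i) := by
  obtain ⟨i, hi⟩ := exists_disjoint_cubeBox s t hst
  refine ⟨i, Finset.disjoint_left.2 fun x hx hx' => ?_⟩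
  simp only [coarseBox, Finset.mem_filter, Finset.mem_univ, true_and] at hx hx'
  exact Finset.disjoint_left.1 hi hx hx'

theorem exists_isOPS_cube (hd : ∀ i, 3 ≤ d i) :
    ∃ S : Set (System fun i => Fin (d i)), IsOPS S ∧
      ∀ ψ : System fun i => Fin (d i), ψ ∈ (Submodule.span ℂ S)ᗮ ↔
        (∃ c : Fin 9 → ℂ, ∀ x, ψ x = c (boxLabel x)) ∧ ∑ x, ψ x = 0 := by
  have : ∀ i, Nonempty (Fin (d i)) := fun i => ⟨Fin.castLE (hd i) 0⟩
  obtain ⟨S, hS, h⟩ := exists_isOPS_of_boxes (coarseBox d) (coarseBox_nonempty hd)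
    exists_disjoint_coarseBox
  refine ⟨S, hS, fun ψ => ?_⟩
  rw [h]
  refine and_congr_left fun _ => ⟨fun hψ => ?_, ?_⟩
  · choose r hr using coarseBox_nonempty hd
    exact ⟨fun t => ψ (r t), fun x => hψ _ _ _ (boxLabel_eq_iff.1 rfl) (hr _)⟩
  · rintro ⟨c, hc⟩ t x y hx hy
    rw [hc, hc, boxLabel_eq_iff.2 hx, boxLabel_eq_iff.2 hy]

/-- The center of the cube and a corner give a box-constant vector of sum zero which does not
vanish at the center. -/
theorem exists_boxConstant_center_ne_zero (hd : ∀ i, 3 ≤ d i) :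
    ∃ w : System fun i => Fin (d i),
      ((∃ c : Fin 9 → ℂ, ∀ x, w x = c (boxLabel x)) ∧ ∑ x, w x = 0) ∧
        w (cell hd 1 1 1) ≠ 0 := by
  let N : Fin 9 → ℂ := fun t => ∑ x : ∀ i, Fin (d i), if boxLabel x = t then 1 else 0
  have hN : N 0 ≠ 0 := by
    have hmem : cell hd 0 0 0 ∈
        Finset.univ.filter fun x : ∀ i, Fin (d i) => boxLabel x = 0 := by
      simp [boxLabel_cell, cubeLabel]
    simp only [N, Finset.sum_boole, ne_eq, Nat.cast_eq_zero, Finset.card_eq_zero]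
    exact Finset.ne_empty_of_mem hmem
  -- `N t` counts the basis labels in box `t`; these weights make the contributions of center and
  -- corner cancel.
  let c : Fin 9 → ℂ := fun t => N 0 * (if t = 8 then 1 else 0) - N 8 * (if t = 0 then 1 else 0)
  refine ⟨WithLp.toLp 2 fun x => c (boxLabel x), ⟨⟨c, fun _ => rfl⟩, ?_⟩, ?_⟩
  · simp only [c, Finset.sum_sub_distrib, ← Finset.mul_sum]
    change N 0 * N 8 - N 8 * N 0 = 0
    ring
  · simpa [c, boxLabel_cell, cubeLabel] using hN

theorem center_eq_zero_of_isProductState_regroup (hd : ∀ i, 3 ≤ d i) {P : Fin 3 → Fin 2}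
    (hP : Function.Surjective P) {φ : System fun i => Fin (d i)} {c : Fin 9 → ℂ}
    (hc : ∀ x, φ x = c (boxLabel x)) (hsum : ∑ x, φ x = 0)
    (hφ : IsProductState (regroup P φ)) : c 8 = 0 := by
  have minors : ∀ i i' j j' k k', c (cubeLabel i j k) * c (cubeLabel i' j' k') =
      c (cubeLabel (if P 0 = 0 then i else i') (if P 1 = 0 then j else j')
        (if P 2 = 0 then k else k')) *
      c (cubeLabel (if P 0 = 0 then i' else i) (if P 1 = 0 then j' else j)
        (if P 2 = 0 then k' else k)) := by
    intro i i' j j' k k'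
    have h := minors_of_isProductState_regroup P hφ (cell hd i j k) (cell hd i' j' k')
    have mix : ∀ i i' j j' k k', (fun a => if P a = 0 then cell hd i j k a else cell hd i' j' k' a)
        = cell hd (if P 0 = 0 then i else i') (if P 1 = 0 then j else j')
          (if P 2 = 0 then k else k') := by
      intro i i' j j' k k'
      funext a
      fin_cases a
      · exact (apply_ite (Fin.castLE (hd 0)) (P 0 = 0) i i').symm
      · exact (apply_ite (Fin.castLE (hd 1)) (P 1 = 0) j j').symm
      · exact (apply_ite (Fin.castLE (hd 2)) (P 2 = 0) k k').symm
    simpa only [mix, hc, boxLabel_cell] using h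
  by_contra h8
  have values : ∀ t, c t = 0 ∨ c t = c 8 := by
    intro t
    -- Surjectivity excludes the two constant assignments; each of the other six isolates one party.
    -- `mul_comm` enters when that party is block 0.
    by_cases h0 : P 0 = 0 <;> by_cases h1 : P 1 = 0 <;> by_cases h2 : P 2 = 0 <;>
      simp only [h0, h1, h2, if_true, if_false] at minors
    · obtain ⟨i, hi⟩ := hP 1
      fin_cases i <;> simp_all
    · exact values_of_minors_third c (fun i i' j j' k k' => minors i i' j j' k k') h8 t
    · exact values_of_minors_second c (fun i i' j j' k k' => minors i i' j j' k k') h8 t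
    · exact values_of_minors_first c
        (fun i i' j j' k k' => (minors i i' j j' k k').trans (mul_comm _ _)) h8 t
    · exact values_of_minors_first c (fun i i' j j' k k' => minors i i' j j' k k') h8 t
    · exact values_of_minors_second c
        (fun i i' j j' k k' => (minors i i' j j' k k').trans (mul_comm _ _)) h8 t
    · exact values_of_minors_third c
        (fun i i' j j' k k' => (minors i i' j j' k k').trans (mul_comm _ _)) h8 t
    · obtain ⟨i, hi⟩ := hP 0
      fin_cases i <;> simp_all
  refine h8 (eq_zero_of_sum_eq_zero (f := fun x => φ x) (fun x => ?_) hsum (x := cell hd 1 1 1) ?_)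
  · simpa only [hc] using values (boxLabel x)
  · change φ _ = c 8
    rw [hc, boxLabel_cell]
    rfl

theorem not_isProductState_of_boxConstant (hd : ∀ i, 3 ≤ d i)
    {φ : System fun i => Fin (d i)} {c : Fin 9 → ℂ}
    (hc : ∀ x, φ x = c (boxLabel x)) (hsum : ∑ x, φ x = 0) : ¬ IsProductState φ := by
  rintro ⟨h0, v, hv⟩
  have hprod : ∀ i j k, c (cubeLabel i j k) = v 0 (Fin.castLE (hd 0) i) *
      v 1 (Fin.castLE (hd 1) j) * v 2 (Fin.castLE (hd 2) k) := by
    intro i j k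
    rw [← boxLabel_cell hd, ← hc, hv]
    simp [tensor, Fin.prod_univ_three, cell]
  have hvals := values_of_product c (fun i => v 0 (Fin.castLE (hd 0) i))
    (fun j => v 1 (Fin.castLE (hd 1) j)) (fun k => v 2 (Fin.castLE (hd 2) k)) hprod
  have hx : ∃ x, φ x ≠ 0 := by
    by_contra! h
    exact h0 (by ext x; exact h x)
  obtain ⟨x, hx⟩ := hx
  refine hx (eq_zero_of_sum_eq_zero (f := fun y => φ y) (fun y => ?_) hsum (x := x) rfl)
  by_cases hy : φ y = 0
  · exact Or.inl hy
  · refine Or.inr ?_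
    change φ y = φ x
    rw [hc] at hx hy
    rw [hc, hc]
    exact hvals _ _ hy hx

end Cube

end ProductBases

theorem theorem1 (d : Fin 3 → ℕ) (hd : ∀ i, 3 ≤ d i) :
    ∃ S : Set (ProductBases.System (fun i => Fin (d i))),
      ProductBases.IsUPB S ∧ ProductBases.IsSUCPBInEveryBipartition S := by
  obtain ⟨S, hS, hperp⟩ := ProductBases.exists_isOPS_cube hd
  obtain ⟨w, hw, hw0⟩ := ProductBases.exists_boxConstant_center_ne_zero hd
  have hwS := (hperp w).2 hw
  refine ⟨S, ⟨⟨hS, ProductBases.finrank_span_lt hwS (fun h => hw0 (by rw [h]; rfl))⟩, ?_⟩, ?_⟩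
  · intro ψ hψ
    obtain ⟨⟨c, hc⟩, hsum⟩ := (hperp ψ).1 hψ
    exact ProductBases.not_isProductState_of_boxConstant hd hc hsum
  · intro P hP
    -- The same `w` and the same center cell serve for all bipartitions.
    refine ProductBases.isSUCPB_of_product_states_vanish (hS.image_regroup P)
      (x₀ := (ProductBases.regroupEquiv P).symm (ProductBases.cell hd 1 1 1))
      ((ProductBases.regroup_mem_orthogonal_iff P S w).2 hwS) hw0 ?_
    intro ψ hψ hprod
    obtain ⟨φ, rfl⟩ := ProductBases.regroup_surjective P ψ
    obtain ⟨⟨c, hc⟩, hsum⟩ :=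
      (hperp φ).1 ((ProductBases.regroup_mem_orthogonal_iff P S φ).1 hψ)
    have h8 := ProductBases.center_eq_zero_of_isProductState_regroup hd hP hc hsum hprod
    change φ (ProductBases.cell hd 1 1 1) = 0
    rw [hc, ProductBases.boxLabel_cell]
    exact h8
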